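/- Assume the Continuum Hypothesis $2^{\aleph_0}=\aleph_1$, and write $\mathfrak{c}=2^{\aleph_0}$. A topological space (no separation axioms assumed) is called quasi-Lindelöf if every open cover of it has a countable subcover, and Lindelöf if it is moreover regular (where regular includes $\mathsf{T}_1$). Let $X$ be a topological space that is productively quasi-Lindelöf, that is, $X\times Y$ is quasi-Lindelöf for every Lindelöf space $Y$. Give the countable power $X^\omega$ the product topology, and suppose that its Lindelöf number satisfies $\ell(X^\omega)\le\mathfrak{c}$, where $\ell(Z)$ denotes the least cardinal $\kappa$ such that every open cover of $Z$ has a subcover of size at most $\kappa$. Then $X$ is powerfully quasi-Lindelöf, that is, $X^\omega$ is quasi-Lindelöf. -/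

import Mathlib

open scoped Cardinal

universe u

/-- A space is quasi-Lindelöf if every open cover has a countable subcover (no separation axiom is
required); this is Mathlib's `LindelofSpace`, see `quasiLindelof_iff` below. -/
abbrev QuasiLindelof (X : Type u) [TopologicalSpace X] : Prop :=
  LindelofSpace X

theorem quasiLindelof_iff (X : Type u) [TopologicalSpace X] :
    QuasiLindelof X ↔ ∀ 𝒰 : Set (Set X), (∀ U ∈ 𝒰, IsOpen U) → ⋃₀ 𝒰 = Set.univ →
      ∃ 𝒱 ⊆ 𝒰, 𝒱.Countable ∧ ⋃₀ 𝒱 = Set.univ := by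
  constructor
  · intro h 𝒰 ho hc
    obtain ⟨t, ht, hs⟩ := (isLindelof_univ (X := X)).elim_countable_subcover
      (fun U : 𝒰 => (U : Set X)) (fun U => ho U U.2) (by rw [← Set.sUnion_eq_iUnion, hc])
    refine ⟨Subtype.val '' t, by rintro _ ⟨U, -, rfl⟩; exact U.2, ht.image _, ?_⟩
    rw [Set.sUnion_image]
    exact Set.univ_subset_iff.mp hs
  · intro h
    refine ⟨isLindelof_iff_countable_subcover.mpr ?_⟩
    intro ι U ho hc
    obtain ⟨𝒱, hV, hcount, hcov⟩ := h (Set.range U) (by rintro _ ⟨i, rfl⟩; exact ho i)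
      (by rw [Set.sUnion_range]; exact Set.univ_subset_iff.mp hc)
    choose g hg using fun V : 𝒱 => hV V.2
    have : Countable 𝒱 := hcount.to_subtype
    refine ⟨Set.range g, Set.countable_range g, fun x _ => ?_⟩
    obtain ⟨V, hVm, hx⟩ := Set.mem_sUnion.mp (hcov.symm ▸ Set.mem_univ x)
    refine Set.mem_biUnion (Set.mem_range_self ⟨V, hVm⟩) ?_
    rw [hg ⟨V, hVm⟩]
    exact hx

/-- A space is Lindelöf if it is regular (including the `T₁` axiom) and quasi-Lindelöf. -/
def RegularLindelof (X : Type u) [TopologicalSpace X] : Prop :=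
  T3Space X ∧ QuasiLindelof X

/-- `X` is productively quasi-Lindelöf if `X × Y` is quasi-Lindelöf for every (regular)
Lindelöf space `Y`. -/
def ProductivelyQuasiLindelof (X : Type u) [TopologicalSpace X] : Prop :=
  ∀ (Y : Type u) [TopologicalSpace Y], RegularLindelof Y → QuasiLindelof (X × Y)

/-- `X` is powerfully quasi-Lindelöf if the countable power of `X`, with the product topology,
is quasi-Lindelöf. -/
def PowerfullyQuasiLindelof (X : Type u) [TopologicalSpace X] : Prop :=
  QuasiLindelof (ℕ → X)

/-- The Lindelöf number of `X`: the least cardinal `κ` such that every open cover of `X` has a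
subcover of size at most `κ`. -/
noncomputable def lindelofNumber (X : Type u) [TopologicalSpace X] : Cardinal.{u} :=
  sInf {κ : Cardinal.{u} | ∀ 𝒰 : Set (Set X), (∀ U ∈ 𝒰, IsOpen U) → ⋃₀ 𝒰 = Set.univ →
    ∃ 𝒱 ⊆ 𝒰, #𝒱 ≤ κ ∧ ⋃₀ 𝒱 = Set.univ}

/-- The infimum defining the Lindelöf number is a minimum. -/
theorem lindelofNumber_le_iff (X : Type u) [TopologicalSpace X] (κ : Cardinal.{u}) :
    lindelofNumber X ≤ κ ↔ ∀ 𝒰 : Set (Set X), (∀ U ∈ 𝒰, IsOpen U) → ⋃₀ 𝒰 = Set.univ →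
      ∃ 𝒱 ⊆ 𝒰, #𝒱 ≤ κ ∧ ⋃₀ 𝒱 = Set.univ := by
  constructor
  · intro h 𝒰 ho hc
    have hmem := csInf_mem (s := {κ : Cardinal.{u} | ∀ 𝒰 : Set (Set X), (∀ U ∈ 𝒰, IsOpen U) →
      ⋃₀ 𝒰 = Set.univ → ∃ 𝒱 ⊆ 𝒰, #𝒱 ≤ κ ∧ ⋃₀ 𝒱 = Set.univ})
      ⟨#(Set X), fun 𝒰 _ hc => ⟨𝒰, subset_rfl, Cardinal.mk_set_le 𝒰, hc⟩⟩
    obtain ⟨𝒱, hV, hcard, hcov⟩ := hmem 𝒰 ho hc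
    exact ⟨𝒱, hV, hcard.trans h, hcov⟩
  · intro h
    exact csInf_le' h

open Set Topology

/-! Refine a cover of `ℕ → X` to at most ℵ₁ boxes and list their sides as `U i`, with `I` of order
type ω₁. A point of the cube `I → Bool` codes a subfamily of `U`, and `NonCover U` consists of the
codes of families that do not cover `X`. It suffices that countably many of the matching boxes in
the power of the cube cover the countable power of `NonCover U`.

Productivity enters through a Michael-type space (`false_of_test_family`): isolated noncovers
concentrated around a set of covers would form a Lindelöf factor whose product with `X` is not
quasi-Lindelöf. By CH the closed G_δ sets of the cube are listed in type ω₁, so diagonalisation can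
produce such noncovers. This shows that `NonCoverBelow U δ` is σ-compact, and then that a σ-ideal
which catches a closed G_δ neighbourhood of every compact set of noncovers contains `NonCover U`
(`nonCover_small`). The second step rests on `captured_of_isClosed`, a Baire category argument at a
suitable countable level.

If no countable family of boxes sufficed, the ideal theorem would yield, one coordinate at a time,
compact sets of noncovers all of whose finite products stay bad (`Bad.exists_succ`). Their full
product is compact, hence covered by finitely many boxes, which see finitely many coordinates: a
contradiction. -/

namespace CantorCube

/-! ### Cylinders, codes and the Michael-type test space -/

section Cube

variable {I : Type u}

/-- The basic clopen subset of the Cantor cube given by finitely many prescribed coordinates. -/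
def cyl (s : Finset (I × Bool)) : Set (I → Bool) := {z | ∀ p ∈ s, z p.1 = p.2}

/-- The closed set omitting all the cylinders of a family. -/
def avoiding (c : Set (Finset (I × Bool))) : Set (I → Bool) := {z | ∀ s ∈ c, z ∉ cyl s}

/-- The codes of closed `G_δ` sets of the Cantor cube. -/
abbrev Code (I : Type u) : Type u := {c : Set (Finset (I × Bool)) // c.Countable}

theorem isClopen_cyl (s : Finset (I × Bool)) : IsClopen (cyl s) := by
  have : cyl s = ⋂ p ∈ s, {z : I → Bool | z p.1 = p.2} := by
    ext z; simp [cyl]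
  rw [this]
  refine isClopen_biInter_finset fun p _ => ?_
  exact (isClopen_discrete {p.2}).preimage (continuous_apply p.1)

theorem isClosed_avoiding (c : Set (Finset (I × Bool))) : IsClosed (avoiding c) := by
  have : avoiding c = ⋂ s ∈ c, (cyl s)ᶜ := by ext z; simp [avoiding]
  rw [this]
  exact isClosed_biInter fun s _ => (isClopen_cyl s).compl.isClosed

theorem exists_cyl_subset {O : Set (I → Bool)} (hO : IsOpen O) {z : I → Bool} (hz : z ∈ O) :
    ∃ s, z ∈ cyl s ∧ cyl s ⊆ O := by
  classical
  obtain ⟨J, u, hu, hs⟩ := isOpen_pi_iff.mp hO z hz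
  refine ⟨J.image fun i => (i, z i), ?_, fun y hy => hs fun i hi => ?_⟩
  · simp [cyl]
  · have := hy (i, z i) (Finset.mem_image_of_mem _ hi)
    simp only at this
    rw [this]
    exact (hu i hi).2

/-- `hL` says that the noncovers `w t` are concentrated around `C`, which makes the test space
Lindelöf. In the product with `X`, a point missed by the family `w t` can be covered over `w t` only
by the `t`-th isolating set, so uncountably many sets are needed. -/
theorem false_of_test_family {X : Type u} [TopologicalSpace X] (hX : ProductivelyQuasiLindelof X)
    [Uncountable I] (U : I → Set X) (hU : ∀ i, IsOpen (U i))
    (C : Set (I → Bool)) (w : I → I → Bool)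
    (hC : ∀ z ∈ C, ∀ x, ∃ i, x ∈ U i ∧ z i = true)
    (hw : ∀ t, ∃ x, ∀ i, x ∈ U i → w t i = false)
    (hL : ∀ O : Set (Finset (I × Bool)), (∀ z ∈ C, ∃ s ∈ O, z ∈ cyl s) →
      ∃ O' ⊆ O, O'.Countable ∧ (∀ z ∈ C, ∃ s ∈ O', z ∈ cyl s) ∧
        {t | ∀ s ∈ O', w t ∉ cyl s}.Countable) : False := by
  classical
  -- The second coordinate isolates the noncovers; a basic neighbourhood of `(z, 0)` constrains
  -- finitely many coordinates of it, so it loses only finitely many `t` on this account.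
  let d : I → I → Bool := fun t i => decide (i = t)
  let Y : Set ((I → Bool) × (I → Bool)) :=
    {q | q.1 ∈ C ∧ q.2 = fun _ => false} ∪ range fun t => (w t, d t)
  have hY : IsLindelof Y := by
    refine isLindelof_of_countable_subcover fun {ι} O hO hcov => ?_
    let A : Set (Finset (I × Bool)) := {s | ∃ (F : Finset I) (j : ι),
      ∀ q : (I → Bool) × (I → Bool), q.1 ∈ cyl s → (∀ t ∈ F, q.2 t = false) → q ∈ O j}
    obtain ⟨A', hA', hcount, hCA, hwA⟩ := hL A (by
      intro z hz
      obtain ⟨j, hj⟩ := mem_iUnion.mp (hcov (Or.inl ⟨hz, rfl⟩ : (z, fun _ => false) ∈ Y))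
      obtain ⟨O₁, O₂, h₁, h₂, hz₁, hz₂, hsub⟩ := isOpen_prod_iff.mp (hO j) _ _ hj
      obtain ⟨s, hzs, hs⟩ := exists_cyl_subset h₁ hz₁
      obtain ⟨r, hzr, hr⟩ := exists_cyl_subset h₂ hz₂
      refine ⟨s, ⟨r.image Prod.fst, j, fun q hq hF => hsub ⟨hs hq, hr fun p hp => ?_⟩⟩, hzs⟩
      rw [hF p.1 (Finset.mem_image_of_mem _ hp), ← hzr p hp])
    have hidx : ∀ t, ∃ k, (w t, d t) ∈ O k := fun t =>
      mem_iUnion.mp (hcov (Or.inr ⟨t, rfl⟩))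
    obtain ⟨t₀⟩ : Nonempty I := inferInstance
    have : Nonempty ι := (hidx t₀).nonempty
    have hA : ∀ s ∈ A', ∃ (F : Finset I) (j : ι), ∀ q : (I → Bool) × (I → Bool),
      q.1 ∈ cyl s → (∀ t ∈ F, q.2 t = false) → q ∈ O j := fun s hs => hA' hs
    choose! F j hFj using hA
    have hbad : ({t | ∀ s ∈ A', w t ∉ cyl s} ∪ ⋃ s ∈ A', (F s : Set I)).Countable :=
      hwA.union (hcount.biUnion fun s _ => (F s).countable_toSet)
    choose k hk using hidx
    refine ⟨j '' A' ∪ k '' _, (hcount.image j).union (hbad.image k), ?_⟩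
    rintro q (⟨hq, hq0⟩ | ⟨t, rfl⟩)
    · obtain ⟨s, hs, hqs⟩ := hCA q.1 hq
      refine mem_biUnion (Or.inl (mem_image_of_mem j hs)) (hFj s hs q hqs fun t _ => by rw [hq0])
    · by_cases ht : t ∈ {t | ∀ s ∈ A', w t ∉ cyl s} ∪ ⋃ s ∈ A', (F s : Set I)
      · exact mem_biUnion (Or.inr (mem_image_of_mem k ht)) (hk t)
      · simp only [mem_union, mem_ofPred_eq, not_or, not_forall, not_not, mem_iUnion,
          not_exists] at ht
        obtain ⟨⟨s, hs, hts⟩, hF⟩ := ht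
        refine mem_biUnion (Or.inl (mem_image_of_mem j hs)) (hFj s hs _ hts fun i hi => ?_)
        have : i ≠ t := fun h => hF s hs (h ▸ hi)
        simpa [d] using this
  have hYL : QuasiLindelof Y := isLindelof_iff_lindelofSpace.mp hY
  have hXY : LindelofSpace (X × Y) := hX Y ⟨inferInstance, hYL⟩
  let W : I ⊕ I → Set (X × Y) := Sum.elim
    (fun i => {q | q.1 ∈ U i ∧ q.2.1.1 i = true}) (fun t => {q | q.2.1.2 t = true})
  have hW : ∀ a, IsOpen (W a) := by
    rintro (i | t)
    · refine ((hU i).preimage continuous_fst).inter ?_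
      exact (isOpen_discrete {true}).preimage (by fun_prop : Continuous fun q : X × Y => q.2.1.1 i)
    · exact (isOpen_discrete {true}).preimage (by fun_prop : Continuous fun q : X × Y => q.2.1.2 t)
  obtain ⟨r, hr, hcov⟩ := (isLindelof_univ (X := X × Y)).elim_countable_subcover W hW (by
    rintro ⟨x, ⟨q, hq⟩⟩ -
    rcases hq with ⟨hq, hq0⟩ | ⟨t, rfl⟩
    · obtain ⟨i, hi⟩ := hC _ hq x
      exact mem_iUnion.mpr ⟨Sum.inl i, hi⟩
    · exact mem_iUnion.mpr ⟨Sum.inr t, by simp [W, d]⟩)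
  obtain ⟨t, ht⟩ : ∃ t, t ∉ Sum.inr ⁻¹' r := by
    by_contra! h
    exact not_countable_univ ((hr.preimage Sum.inr_injective).mono fun t _ => h t)
  obtain ⟨x, hx⟩ := hw t
  have := hcov (mem_univ (x, ⟨(w t, d t), Or.inr ⟨t, rfl⟩⟩))
  simp only [mem_iUnion] at this
  obtain ⟨a | a, har, ha⟩ := this
  · exact absurd ha.2 (by simp [hx a ha.1])
  · have : a = t := by simpa [W, d] using ha
    exact ht (this ▸ har)

end Cube

/-! ### Countable levels of the cube and σ-compactness of noncovers -/

section Level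

variable {I : Type u} [LinearOrder I]

/-- The support of a cylinder lies strictly below `δ`. -/
def Below (δ : I) (s : Finset (I × Bool)) : Prop := ∀ p ∈ s, p.1 < δ

/-- The set depends only on the coordinates below `δ`. -/
def DependsBelow (δ : I) (A : Set (I → Bool)) : Prop :=
  ∀ ⦃z z'⦄, z ∈ A → (∀ i < δ, z i = z' i) → z' ∈ A

theorem Below.mono {δ ξ : I} (h : δ ≤ ξ) {s : Finset (I × Bool)} (hs : Below δ s) : Below ξ s :=
  fun p hp => (hs p hp).trans_le h

theorem DependsBelow.mono {δ ξ : I} (h : δ ≤ ξ) {A : Set (I → Bool)} (hA : DependsBelow δ A) :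
    DependsBelow ξ A := fun _ _ hz hzz => hA hz fun i hi => hzz i (hi.trans_le h)

theorem DependsBelow.compl {δ : I} {A : Set (I → Bool)} (hA : DependsBelow δ A) :
    DependsBelow δ Aᶜ := fun _ _ hz hzz hz' => hz (hA hz' fun i hi => (hzz i hi).symm)

theorem DependsBelow.inter {δ : I} {A B : Set (I → Bool)} (hA : DependsBelow δ A)
    (hB : DependsBelow δ B) : DependsBelow δ (A ∩ B) :=
  fun _ _ hz hzz => ⟨hA hz.1 hzz, hB hz.2 hzz⟩

theorem Below.dependsBelow {δ : I} {s : Finset (I × Bool)} (hs : Below δ s) :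
    DependsBelow δ (cyl s) := fun _ _ hz hzz p hp => by rw [← hzz p.1 (hs p hp), hz p hp]

theorem dependsBelow_avoiding {δ : I} {c : Set (Finset (I × Bool))} (hc : ∀ s ∈ c, Below δ s) :
    DependsBelow δ (avoiding c) := fun _ _ hz hzz s hs hz' =>
  hz s hs ((hc s hs).dependsBelow hz' fun i hi => (hzz i hi).symm)

theorem countable_below (hI : ∀ i : I, (Iio i).Countable) (δ : I) :
    {s : Finset (I × Bool) | Below δ s}.Countable := by
  have h : (Iio δ ×ˢ (univ : Set Bool)).Countable := (hI δ).prod countable_univ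
  refine ((countable_ofPred_finite_subset h).preimage
    (Finset.coe_injective (α := I × Bool))).mono fun s hs => ?_
  exact ⟨s.finite_toSet, fun p hp => ⟨hs p hp, mem_univ _⟩⟩

/-- Tube lemma: the fibre over the restriction of `z` below `δ` is compact. -/
theorem exists_below_finite_cover {δ : I} {O : Set (Finset (I × Bool))} {z : I → Bool}
    (h : ∀ z', (∀ i < δ, z i = z' i) → ∃ s ∈ O, z' ∈ cyl s) :
    ∃ s, Below δ s ∧ z ∈ cyl s ∧ ∃ F : Finset (Finset (I × Bool)), (∀ r ∈ F, r ∈ O) ∧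
      ∀ y ∈ cyl s, ∃ r ∈ F, y ∈ cyl r := by
  classical
  have hcl : IsClosed {z' : I → Bool | ∀ i < δ, z i = z' i} := by
    simp only [ofPred_forall]
    exact isClosed_iInter fun i => isClosed_iInter fun _ =>
      isClosed_eq continuous_const (continuous_apply i)
  obtain ⟨F, hFO, hF⟩ := hcl.isCompact.elim_finite_subcover_image (b := O) (c := cyl)
    (fun s _ => (isClopen_cyl s).isOpen) (fun z' hz' => by simpa using h z' hz')
  obtain ⟨hfin, hF⟩ := hF
  let supp : Finset I := (hfin.toFinset.biUnion fun r => r.image Prod.fst).filter (· < δ)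
  refine ⟨supp.image fun i => (i, z i), ?_, ?_, hfin.toFinset, fun r hr => hFO (by simpa using hr),
    fun y hy => ?_⟩
  · intro p hp
    obtain ⟨i, hi, rfl⟩ := Finset.mem_image.mp hp
    exact (Finset.mem_filter.mp hi).2
  · intro p hp
    obtain ⟨i, -, rfl⟩ := Finset.mem_image.mp hp
    rfl
  · have := hF (show (fun i => if i < δ then z i else y i) ∈ _ from fun i hi => by simp [hi])
    simp only [mem_iUnion] at this
    obtain ⟨r, hr, hyr⟩ := this
    refine ⟨r, by simpa using hr, fun p hp => ?_⟩
    rw [← hyr p hp]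
    dsimp only
    split_ifs with hlt
    · exact hy (p.1, z p.1) (Finset.mem_image.mpr ⟨p.1, Finset.mem_filter.mpr
        ⟨Finset.mem_biUnion.mpr ⟨r, by simpa using hr, Finset.mem_image_of_mem _ hp⟩, hlt⟩, rfl⟩)
    · rfl

/-- There are only countably many finite supports below `δ`, so the tubes give a countable subcover.
-/
theorem exists_below_countable_cover (hI : ∀ i : I, (Iio i).Countable) {δ : I}
    {O : Set (Finset (I × Bool))} {D : Set (I → Bool)} (hD : DependsBelow δ D)
    (h : ∀ z ∈ D, ∃ s ∈ O, z ∈ cyl s) :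
    ∃ c : Code I, (∀ s ∈ c.1, Below δ s) ∧ (∀ z ∈ D, ∃ s ∈ c.1, z ∈ cyl s) ∧
      ∃ O' ⊆ O, O'.Countable ∧ ∀ s ∈ c.1, ∀ y ∈ cyl s, ∃ r ∈ O', y ∈ cyl r := by
  let c : Set (Finset (I × Bool)) := {s | Below δ s ∧
    ∃ F : Finset (Finset (I × Bool)), (∀ r ∈ F, r ∈ O) ∧ ∀ y ∈ cyl s, ∃ r ∈ F, y ∈ cyl r}
  have hc : c.Countable := (countable_below hI δ).mono fun s hs => hs.1
  have hex : ∀ s ∈ c, ∃ F : Finset (Finset (I × Bool)), (∀ r ∈ F, r ∈ O) ∧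
    ∀ y ∈ cyl s, ∃ r ∈ F, y ∈ cyl r := fun s hs => hs.2
  choose! F hFO hF using hex
  refine ⟨⟨c, hc⟩, fun s hs => hs.1, fun z hz => ?_, ⋃ s ∈ c, (F s : Set (Finset (I × Bool))), ?_,
    hc.biUnion fun s _ => (F s).countable_toSet, fun s hs y hy => ?_⟩
  · obtain ⟨s, hs, hzs, hF⟩ := exists_below_finite_cover (O := O) (z := z) (δ := δ)
      fun z' hz' => h z' (hD hz hz')
    exact ⟨s, ⟨hs, hF⟩, hzs⟩
  · exact iUnion₂_subset fun s hs r hr => hFO s hs r hr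
  · obtain ⟨r, hr, hyr⟩ := hF s hs y hy
    exact ⟨r, mem_biUnion hs hr, hyr⟩

theorem exists_gt_of_countable [Uncountable I] (hI : ∀ i : I, (Iio i).Countable) {S : Set I}
    (hS : S.Countable) : ∃ δ, ∀ i ∈ S, i < δ := by
  by_contra! h
  refine not_countable_univ (α := I) ((hS.biUnion fun i _ => (hI i).union
    (countable_singleton i)).mono fun δ _ => ?_)
  obtain ⟨i, hi, hle⟩ := h δ
  exact mem_biUnion hi (hle.lt_or_eq.imp id fun h => h)

theorem exists_dependsBelow_avoiding [Uncountable I] (hI : ∀ i : I, (Iio i).Countable) (c : Code I) :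
    ∃ δ, DependsBelow δ (avoiding c.1) := by
  obtain ⟨δ, hδ⟩ := exists_gt_of_countable hI (S := ⋃ s ∈ c.1, Prod.fst '' (s : Set (I × Bool)))
    (c.2.biUnion fun s _ => (s.countable_toSet).image _)
  exact ⟨δ, dependsBelow_avoiding fun s hs p hp =>
    hδ p.1 (mem_biUnion hs (mem_image_of_mem _ hp))⟩

variable {X : Type u}

/-- The points of the cube whose first `δ` coordinates select a family not covering `X`. -/
def NonCoverBelow (U : I → Set X) (δ : I) : Set (I → Bool) :=
  {z | ∃ x, ∀ i < δ, x ∈ U i → z i = false}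

/-- The points of the cube which select a family not covering `X`. -/
def NonCover (U : I → Set X) : Set (I → Bool) := {z | ∃ x, ∀ i, x ∈ U i → z i = false}

theorem dependsBelow_nonCoverBelow (U : I → Set X) (δ : I) :
    DependsBelow δ (NonCoverBelow U δ) := by
  rintro z z' ⟨x, hx⟩ hzz
  exact ⟨x, fun i hi hxi => by rw [← hzz i hi, hx i hi hxi]⟩

theorem nonCover_subset (U : I → Set X) (δ : I) : NonCover U ⊆ NonCoverBelow U δ :=
  fun _ ⟨x, hx⟩ => ⟨x, fun i _ => hx i⟩

theorem nonCoverBelow_anti (U : I → Set X) {δ ξ : I} (h : δ ≤ ξ) :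
    NonCoverBelow U ξ ⊆ NonCoverBelow U δ :=
  fun _ ⟨x, hx⟩ => ⟨x, fun i hi => hx i (hi.trans_le h)⟩

variable [TopologicalSpace X]

theorem lindelofSpace_of_productively (hX : ProductivelyQuasiLindelof X) : LindelofSpace X := by
  have : LindelofSpace (X × PUnit.{u + 1}) := hX PUnit ⟨inferInstance, inferInstance⟩
  have h := isLindelof_range (continuous_fst : Continuous (Prod.fst : X × PUnit.{u + 1} → X))
  rw [Prod.range_fst] at h
  exact isLindelof_univ_iff.mp h

/-- A covering subfamily has a countable covering subfamily, whose indices are bounded in `I`. -/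
theorem mem_nonCover_of_forall [Uncountable I] [LindelofSpace X]
    (hI : ∀ i : I, (Iio i).Countable) {U : I → Set X} (hU : ∀ i, IsOpen (U i)) {z : I → Bool}
    (h : ∀ δ, z ∈ NonCoverBelow U δ) : z ∈ NonCover U := by
  by_contra hz
  simp only [NonCover, mem_ofPred_eq, not_exists, not_forall] at hz
  obtain ⟨r, hr, hcov⟩ := (isLindelof_univ (X := X)).elim_countable_subcover
    (fun i : {i // z i = true} => U i) (fun i => hU i) (fun x _ => by
      obtain ⟨i, hi, hzi⟩ := hz x
      exact mem_iUnion.mpr ⟨⟨i, by simpa using hzi⟩, hi⟩)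
  obtain ⟨δ, hδ⟩ := exists_gt_of_countable hI (hr.image Subtype.val)
  obtain ⟨x, hx⟩ := h δ
  have := hcov (mem_univ x)
  simp only [mem_iUnion] at this
  obtain ⟨i, hi, hxi⟩ := this
  have := hx i (hδ i (mem_image_of_mem _ hi)) hxi
  simp [i.2] at this

/-- At each countable level, the set of noncovers is `σ`-compact. -/
theorem nonCoverBelow_sigmaCompact [Uncountable I] (hX : ProductivelyQuasiLindelof X)
    (hI : ∀ i : I, (Iio i).Countable) {e : I → Code I} (he : Function.Surjective e)
    {U : I → Set X} (hU : ∀ i, IsOpen (U i)) (δ : I) :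
    ∃ A : Set (Code I), A.Countable ∧ (∀ a ∈ A, DependsBelow δ (avoiding a.1) ∧
      avoiding a.1 ⊆ NonCoverBelow U δ) ∧ NonCoverBelow U δ ⊆ ⋃ a ∈ A, avoiding a.1 := by
  classical
  by_contra! hcon
  -- Diagonalisation: the admissible codes listed before `t` are countably many, so they do not
  -- exhaust the noncovers.
  have hw : ∀ t, ∃ z ∈ NonCoverBelow U δ, ∀ α < t, DependsBelow δ (avoiding (e α).1) →
      avoiding (e α).1 ⊆ NonCoverBelow U δ → z ∉ avoiding (e α).1 := by
    intro t
    have := hcon (e '' {α | α < t ∧ DependsBelow δ (avoiding (e α).1) ∧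
      avoiding (e α).1 ⊆ NonCoverBelow U δ}) (((hI t).mono fun α h => h.1).image e)
      (by rintro _ ⟨α, hα, rfl⟩; exact hα.2)
    obtain ⟨z, hz, hz'⟩ := not_subset.mp this
    refine ⟨z, hz, fun α hα h₁ h₂ h₃ => hz' ?_⟩
    exact mem_biUnion (mem_image_of_mem e ⟨hα, h₁, h₂⟩) h₃
  choose w hwN hw using hw
  refine false_of_test_family hX (fun i => if i < δ then U i else ∅) (fun i => ?_)
    (NonCoverBelow U δ)ᶜ w ?_ ?_ ?_
  · split_ifs
    exacts [hU i, isOpen_empty]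
  · intro z hz x
    simp only [NonCoverBelow, mem_compl_iff, mem_ofPred_eq, not_exists, not_forall] at hz
    obtain ⟨i, hi, hxi, hzi⟩ := hz x
    exact ⟨i, by simpa [hi] using hxi, by simpa using hzi⟩
  · intro t
    obtain ⟨x, hx⟩ := hwN t
    refine ⟨x, fun i hi => ?_⟩
    by_cases h : i < δ
    · exact hx i h (by simpa [h] using hi)
    · simp [h] at hi
  · intro O hO
    obtain ⟨c, hcδ, hcov, O', hO', hcount, hcO⟩ :=
      exists_below_countable_cover hI (dependsBelow_nonCoverBelow U δ).compl hO
    have hall : ∀ z ∈ (NonCoverBelow U δ)ᶜ, ∃ s ∈ O', z ∈ cyl s := fun z hz => by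
      obtain ⟨s, hs, hzs⟩ := hcov z hz
      exact hcO s hs z hzs
    refine ⟨O', hO', hcount, hall, ?_⟩
    -- What the countable cover omits is itself an admissible closed set, so `w t` avoids it for
    -- every `t` beyond its index.
    obtain ⟨α, rfl⟩ := he c
    have hsub : avoiding (e α).1 ⊆ NonCoverBelow U δ := fun z hz => by
      by_contra h
      obtain ⟨s, hs, hzs⟩ := hcov z h
      exact hz s hs hzs
    refine ((hI α).union (countable_singleton α)).mono fun t ht => ?_
    by_contra hlt
    have hlt : α < t := by
      simp only [mem_union, mem_Iio, mem_singleton_iff, not_or, not_lt] at hlt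
      exact lt_of_le_of_ne hlt.1 (Ne.symm hlt.2)
    refine hw t α hlt (dependsBelow_avoiding hcδ) hsub fun s hs hts => ?_
    obtain ⟨r, hr, htr⟩ := hcO s hs _ hts
    exact ht r hr htr

end Level

/-! ### Stages, cores and the Baire category argument -/

section Stage

variable {I : Type u} [LinearOrder I]

/-- The union of the members of the families of index less than `δ`. -/
def stage (J : I → Set (Set (I → Bool))) (δ : I) : Set (I → Bool) :=
  {z | ∃ ξ < δ, ∃ A ∈ J ξ, z ∈ A}

theorem stage_mono (J : I → Set (Set (I → Bool))) {δ ξ : I} (h : δ ≤ ξ) :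
    stage J δ ⊆ stage J ξ := fun _ ⟨η, hη, hA⟩ => ⟨η, hη.trans_le h, hA⟩

theorem dependsBelow_stage {J : I → Set (Set (I → Bool))}
    (hJ : ∀ δ, ∀ A ∈ J δ, DependsBelow δ A) (δ : I) : DependsBelow δ (stage J δ) := by
  rintro z z' ⟨ξ, hξ, A, hA, hz⟩ hzz
  exact ⟨ξ, hξ, A, hA, (hJ ξ A hA).mono hξ.le hz hzz⟩

/-- `K` is contained in some stage. -/
def Captured (J : I → Set (Set (I → Bool))) (K : Set (I → Bool)) : Prop := ∃ δ, K ⊆ stage J δ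

theorem Captured.mono {J : I → Set (Set (I → Bool))} {K L : Set (I → Bool)} (h : K ⊆ L) :
    Captured J L → Captured J K := fun ⟨δ, hδ⟩ => ⟨δ, h.trans hδ⟩

theorem Captured.biUnion [Uncountable I] (hI : ∀ i : I, (Iio i).Countable)
    {J : I → Set (Set (I → Bool))} {κ : Type*} {S : Set κ} (hS : S.Countable)
    {K : κ → Set (I → Bool)} (h : ∀ k ∈ S, Captured J (K k)) : Captured J (⋃ k ∈ S, K k) := by
  have : Nonempty I := inferInstance
  choose! δ hδ using h
  obtain ⟨ξ, hξ⟩ := exists_gt_of_countable hI (hS.image δ)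
  exact ⟨ξ, iUnion₂_subset fun k hk =>
    (hδ k hk).trans (stage_mono J (hξ _ (mem_image_of_mem _ hk)).le)⟩

theorem Captured.union
    {J : I → Set (Set (I → Bool))} {K L : Set (I → Bool)}
    (hK : Captured J K) (hL : Captured J L) : Captured J (K ∪ L) := by
  obtain ⟨δ, hδ⟩ := hK
  obtain ⟨ξ, hξ⟩ := hL
  exact ⟨max δ ξ, union_subset (hδ.trans (stage_mono J (le_max_left _ _)))
    (hξ.trans (stage_mono J (le_max_right _ _)))⟩

/-- The points all of whose neighbourhoods of support below `δ` meet `K` in a set contained in no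
stage. -/
def core (J : I → Set (Set (I → Bool))) (K : Set (I → Bool)) (δ : I) : Set (I → Bool) :=
  {z | ∀ s, Below δ s → z ∈ cyl s → ¬ Captured J (K ∩ cyl s)}

section core

variable (J : I → Set (Set (I → Bool))) (K : Set (I → Bool))

theorem dependsBelow_core (δ : I) : DependsBelow δ (core J K δ) := fun _ _ hz hzz s hs hz' =>
  hz s hs (hs.dependsBelow hz' fun i hi => (hzz i hi).symm)

theorem core_anti {δ ξ : I} (h : δ ≤ ξ) : core J K ξ ⊆ core J K δ :=
  fun _ hz s hs => hz s (hs.mono h)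

theorem isClosed_core (δ : I) : IsClosed (core J K δ) := by
  have : core J K δ = ⋂ s, ⋂ (_ : Below δ s ∧ Captured J (K ∩ cyl s)), (cyl s)ᶜ := by
    ext z
    simp only [core, mem_ofPred_eq, mem_iInter, mem_compl_iff]
    exact ⟨fun h s hs hz => h s hs.1 hz hs.2, fun h s hs hz hc => h s ⟨hs, hc⟩ hz⟩
  rw [this]
  exact isClosed_iInter fun s => isClosed_iInter fun _ => (isClopen_cyl s).compl.isClosed

theorem captured_diff_core [Uncountable I] (hI : ∀ i : I, (Iio i).Countable) (δ : I) :
    Captured J (K \ core J K δ) := by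
  refine Captured.mono ?_ (Captured.biUnion hI (S := {s | Below δ s ∧ Captured J (K ∩ cyl s)})
    (K := fun s => K ∩ cyl s) ((countable_below hI δ).mono fun s hs => hs.1) fun s hs => hs.2)
  rintro z ⟨hzK, hz⟩
  simp only [core, mem_ofPred_eq, not_forall, not_not] at hz
  obtain ⟨s, hs, hzs, hc⟩ := hz
  exact mem_biUnion (⟨hs, hc⟩ : s ∈ {s | Below δ s ∧ Captured J (K ∩ cyl s)}) ⟨hzK, hzs⟩

/-- A point of the core at a level extends to any family of sets that is not locally captured. -/
theorem exists_agree_of_mem_core [Uncountable I] (hI : ∀ i : I, (Iio i).Countable) {δ : I}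
    {z : I → Bool} (hz : z ∈ core J K δ) {O : Set (Finset (I × Bool))}
    (hO : ∀ s ∈ O, Captured J (K ∩ cyl s)) :
    ∃ z', (∀ i < δ, z i = z' i) ∧ ∀ s ∈ O, z' ∉ cyl s := by
  by_contra! h
  obtain ⟨s, hs, hzs, F, hF, hcov⟩ := exists_below_finite_cover h
  refine hz s hs hzs (Captured.mono ?_ (Captured.biUnion hI (S := (F : Set _))
    (K := fun r => K ∩ cyl r) F.countable_toSet fun r hr => hO r (hF r hr)))
  rintro y ⟨hyK, hys⟩
  obtain ⟨r, hr, hyr⟩ := hcov y hys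
  exact mem_biUnion (show r ∈ (F : Set _) from hr) ⟨hyK, hyr⟩

theorem exists_agree_mem_core [Uncountable I] (hI : ∀ i : I, (Iio i).Countable) {δ : I}
    {z : I → Bool} (hz : z ∈ core J K δ) (ξ : I) :
    ∃ z' ∈ core J K ξ, ∀ i < δ, z i = z' i := by
  obtain ⟨z', hzz, h⟩ := exists_agree_of_mem_core J K hI hz
    (O := {s | Below ξ s ∧ Captured J (K ∩ cyl s)}) fun s hs => hs.2
  exact ⟨z', fun s hs hz' hc => h s ⟨hs, hc⟩ hz', hzz⟩

theorem exists_agree_mem [Uncountable I] (hI : ∀ i : I, (Iio i).Countable) (hK : IsClosed K)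
    {δ : I} {z : I → Bool} (hz : z ∈ core J K δ) : ∃ z' ∈ K, ∀ i < δ, z i = z' i := by
  obtain ⟨z', hzz, h⟩ := exists_agree_of_mem_core J K hI hz
    (O := {s | cyl s ⊆ Kᶜ}) fun s hs => ⟨δ, fun y hy => absurd hy.1 (hs hy.2)⟩
  refine ⟨z', ?_, hzz⟩
  by_contra hz'
  obtain ⟨s, hzs, hs⟩ := exists_cyl_subset hK.isOpen_compl hz'
  exact h s hs hzs

variable {J K}

/-- If an intersection of cores lies in a stage, then already one of the cores does. -/
theorem exists_core_subset_stage [Uncountable I] (hI : ∀ i : I, (Iio i).Countable)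
    (hJ : ∀ δ, ∀ A ∈ J δ, DependsBelow δ A) (s : Finset (I × Bool)) {ξ : I}
    (h : (⋂ δ, core J K δ ∩ cyl s) ⊆ stage J ξ) : ∃ η, core J K η ∩ cyl s ⊆ stage J ξ := by
  classical
  have : Nonempty I := inferInstance
  -- Off the stage, which depends on countably many coordinates, countably many cylinders missing
  -- some core suffice; the cores decrease, so one `η` serves them all.
  obtain ⟨c, hcξ, hcov, O', hO', hcount, hcO⟩ := exists_below_countable_cover hI
    (O := {r | ∃ δ, ∀ y ∈ cyl r, y ∉ core J K δ ∩ cyl s})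
    (dependsBelow_stage hJ ξ).compl (by
      intro z hz
      have hz' : ∃ δ, z ∉ core J K δ ∩ cyl s := by
        by_contra! h'
        exact hz (h (mem_iInter.mpr h'))
      obtain ⟨δ, hδ⟩ := hz'
      obtain ⟨r, hzr, hr⟩ := exists_cyl_subset
        ((isClosed_core J K δ).inter (isClopen_cyl s).isClosed).isOpen_compl hδ
      exact ⟨r, ⟨δ, fun y hy => hr hy⟩, hzr⟩)
  have hO'' : ∀ r ∈ O', ∃ δ, ∀ y ∈ cyl r, y ∉ core J K δ ∩ cyl s := fun r hr => hO' hr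
  choose! δ hδ using hO''
  obtain ⟨η, hη⟩ := exists_gt_of_countable hI (hcount.image δ)
  refine ⟨η, fun z hz => ?_⟩
  by_contra hzξ
  obtain ⟨r, hr, hzr⟩ := hcov z hzξ
  obtain ⟨r', hr', hzr'⟩ := hcO r hr z hzr
  exact hδ r' hr' z hzr' ⟨core_anti J K (hη _ (mem_image_of_mem _ hr')).le hz.1, hz.2⟩

end core

/-- Closing off: `δ` is the supremum of ω iterates of `g`, and a finite support below `δ` lies below
one of them. -/
theorem exists_closed_level [Uncountable I] [WellFoundedLT I] (hI : ∀ i : I, (Iio i).Countable)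
    (f : Finset (I × Bool) → I) : ∃ δ, ∀ s, Below δ s → f s < δ := by
  have hstep : ∀ δ : I, ∃ ξ, δ < ξ ∧ ∀ s, Below δ s → f s < ξ := fun δ => by
    obtain ⟨ξ, hξ⟩ := exists_gt_of_countable hI
      (((countable_below hI δ).image f).union (countable_singleton δ))
    exact ⟨ξ, hξ δ (Or.inr rfl), fun s hs => hξ _ (Or.inl (mem_image_of_mem f hs))⟩
  choose g hg hgf using hstep
  obtain ⟨δ₀⟩ : Nonempty I := inferInstance
  let d : ℕ → I := fun n => g^[n] δ₀
  have hd : ∀ n, d (n + 1) = g (d n) := fun n => Function.iterate_succ_apply' g n δ₀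
  have hmono : StrictMono d := strictMono_nat_of_lt_succ fun n => by rw [hd]; exact hg _
  have hub : (upperBounds (range d)).Nonempty := by
    obtain ⟨ξ, hξ⟩ := exists_gt_of_countable hI (countable_range d)
    exact ⟨ξ, fun i hi => (hξ i hi).le⟩
  let δ := wellFounded_lt.min (upperBounds (range d)) hub
  have hδ : ∀ n, d n ≤ δ := fun n => wellFounded_lt.min_mem _ hub (mem_range_self n)
  have hlt : ∀ i < δ, ∃ n, i < d n := by
    intro i hi
    by_contra! h
    exact wellFounded_lt.not_lt_min (upperBounds (range d)) (x := i)
      (by rintro _ ⟨n, rfl⟩; exact h n) hi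
  refine ⟨δ, fun s hs => ?_⟩
  have : ∃ n, Below (d n) s := by
    have h : ∀ p ∈ s, ∃ n, p.1 < d n := fun p hp => hlt _ (hs p hp)
    choose! n hn using h
    exact ⟨s.sup n, fun p hp => (hn p hp).trans_le (hmono.monotone (Finset.le_sup hp))⟩
  obtain ⟨n, hn⟩ := this
  exact ((hgf _ s hn).trans_eq (hd n).symm).trans_le (hδ _)

/-- If `K` is not captured, some level `δ` closed under the witnesses `f` makes the non-members of
`NonCoverBelow U δ` dense in the core. Yet the core is covered by the countably many closed sets of
`A δ` and of earlier `J ξ`. By Baire one of them contains a relatively open piece: one from `A δ`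
contradicts density, one from `J ξ` captures the piece. -/
theorem captured_of_isClosed {X : Type u} [TopologicalSpace X] [LindelofSpace X]
    [Uncountable I] [WellFoundedLT I] (hI : ∀ i : I, (Iio i).Countable)
    {U : I → Set X} (hU : ∀ i, IsOpen (U i)) {A : I → Set (Set (I → Bool))}
    (hAc : ∀ δ, (A δ).Countable) (hAcl : ∀ δ, ∀ a ∈ A δ, IsClosed a)
    (hAd : ∀ δ, ∀ a ∈ A δ, DependsBelow δ a) (hAN : ∀ δ, ∀ a ∈ A δ, a ⊆ NonCoverBelow U δ)
    (hNA : ∀ δ, NonCoverBelow U δ ⊆ ⋃₀ A δ) {J : I → Set (Set (I → Bool))}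
    (hJc : ∀ δ, (J δ).Countable) (hJcl : ∀ δ, ∀ a ∈ J δ, IsClosed a)
    (hJd : ∀ δ, ∀ a ∈ J δ, DependsBelow δ a) (hJN : ∀ δ, ∀ a ∈ J δ, a ⊆ NonCoverBelow U δ)
    (hcpt : ∀ K, IsCompact K → K ⊆ NonCover U → Captured J K)
    {K : Set (I → Bool)} (hK : IsClosed K) (hKJ : K ⊆ ⋃ δ, stage J δ) : Captured J K := by
  classical
  by_contra hbad
  have hcap : ∀ (s : Finset (I × Bool)) (δ ξ : I), core J K δ ∩ cyl s ⊆ stage J ξ →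
      Captured J (K ∩ cyl s) := fun s δ ξ h =>
    Captured.mono (L := K \ core J K δ ∪ core J K δ ∩ cyl s) (fun y hy => by
      by_cases hyc : y ∈ core J K δ
      exacts [Or.inr ⟨hyc, hy.2⟩, Or.inl ⟨hy.1, hyc⟩])
      ((captured_diff_core J K hI δ).union ⟨ξ, h⟩)
  -- Otherwise the intersection of the cores in `cyl s` would be a compact set of noncovers, so
  -- captured, and one core would already lie in a stage.
  have hout : ∀ s, ¬ Captured J (K ∩ cyl s) → ∃ δ, Below δ s ∧
      ∃ z ∈ core J K δ ∩ cyl s, z ∉ NonCoverBelow U δ := by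
    intro s hs
    by_contra! h
    obtain ⟨δs, hδs⟩ := exists_gt_of_countable hI (S := Prod.fst '' (s : Set (I × Bool)))
      (s.countable_toSet.image _)
    have hsub : (⋂ δ, core J K δ ∩ cyl s) ⊆ NonCover U := fun z hz =>
      mem_nonCover_of_forall hI hU fun δ => nonCoverBelow_anti U (le_max_left δ δs)
        (h (max δ δs) (fun p hp => (hδs _ (mem_image_of_mem _ hp)).trans_le (le_max_right _ _))
          z (mem_iInter.mp hz _))
    obtain ⟨ξ, hξ⟩ := hcpt _ (isClosed_iInter fun δ =>
      (isClosed_core J K δ).inter (isClopen_cyl s).isClosed).isCompact hsub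
    obtain ⟨η, hη⟩ := exists_core_subset_stage hI hJd s hξ
    exact hs (hcap s η ξ hη)
  have : Nonempty I := inferInstance
  choose! f hfs z₀ hz₀ hz₀N using hout
  obtain ⟨δ, hδ⟩ := exists_closed_level hI f
  have hdense : ∀ s, Below δ s → ¬ Captured J (K ∩ cyl s) →
      ∃ z ∈ core J K δ ∩ cyl s, z ∉ NonCoverBelow U δ := by
    intro s hs hcs
    obtain ⟨z', hz', hzz⟩ := exists_agree_mem_core J K hI (hz₀ s hcs).1 δ
    refine ⟨z', ⟨hz', (hfs s hcs).dependsBelow (hz₀ s hcs).2 hzz⟩, fun hN => hz₀N s hcs ?_⟩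
    exact dependsBelow_nonCoverBelow U (f s) (nonCoverBelow_anti U (hδ s hs).le hN)
      fun i hi => (hzz i hi).symm
  let S : Set (Set (I → Bool)) := A δ ∪ ⋃ ξ ∈ Iio δ, J ξ
  have hSc : S.Countable := (hAc δ).union ((hI δ).biUnion fun ξ _ => hJc ξ)
  have hScl : ∀ B ∈ S, IsClosed B := by
    rintro B (hB | hB)
    · exact hAcl δ B hB
    · obtain ⟨ξ, -, hB⟩ := mem_iUnion₂.mp hB
      exact hJcl ξ B hB
  have hSd : ∀ B ∈ S, DependsBelow δ B := by
    rintro B (hB | hB)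
    · exact hAd δ B hB
    · obtain ⟨ξ, hξ, hB⟩ := mem_iUnion₂.mp hB
      exact (hJd ξ B hB).mono (le_of_lt hξ)
  have hcov : ∀ z ∈ core J K δ, ∃ B ∈ S, z ∈ B := by
    intro z hz
    by_cases hN : z ∈ NonCoverBelow U δ
    · obtain ⟨B, hB, hzB⟩ := hNA δ hN
      exact ⟨B, Or.inl hB, hzB⟩
    · obtain ⟨z', hz'K, hzz⟩ := exists_agree_mem J K hI hK hz
      obtain ⟨η, ξ, -, B, hB, hz'B⟩ := mem_iUnion.mp (hKJ hz'K)
      -- A set from `J ξ` with `δ ≤ ξ` would put `z'`, hence `z`, into `NonCoverBelow U δ`.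
      have hξ : ξ < δ := by
        by_contra! hle
        exact hN (dependsBelow_nonCoverBelow U δ (nonCoverBelow_anti U hle (hJN ξ B hB hz'B))
          fun i hi => (hzz i hi).symm)
      exact ⟨B, Or.inr (mem_biUnion hξ hB),
        (hJd ξ B hB).mono hξ.le hz'B fun i hi => (hzz i hi).symm⟩
  have hne : (core J K δ).Nonempty := by
    by_contra! hempty
    have := captured_diff_core J K hI δ
    rw [hempty, sdiff_empty] at this
    exact hbad this
  have : Nonempty (core J K δ) := hne.to_subtype
  have : CompactSpace (core J K δ) :=
    isCompact_iff_compactSpace.mp (isClosed_core J K δ).isCompact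
  have : Countable S := hSc.to_subtype
  obtain ⟨⟨B, hB⟩, ⟨z, hzcore⟩, hzint⟩ := nonempty_interior_of_iUnion_of_closed
    (f := fun B : S => (Subtype.val ⁻¹' B.1 : Set (core J K δ)))
    (fun B => (hScl B.1 B.2).preimage continuous_subtype_val) (by
      refine eq_univ_of_forall fun z => ?_
      obtain ⟨B, hB, hzB⟩ := hcov z.1 z.2
      exact mem_iUnion.mpr ⟨⟨B, hB⟩, hzB⟩)
  obtain ⟨O, hOsub, hO, hzO⟩ := mem_interior.mp hzint
  obtain ⟨G, hG, rfl⟩ := isOpen_induced_iff.mp hO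
  obtain ⟨r, hzr, hrG⟩ := exists_cyl_subset hG hzO
  let s := r.filter fun p => p.1 < δ
  have hs : Below δ s := fun p hp => (Finset.mem_filter.mp hp).2
  have hzs : z ∈ cyl s := fun p hp => hzr p (Finset.mem_filter.mp hp).1
  have hsB : core J K δ ∩ cyl s ⊆ B := by
    rintro y ⟨hyc, hys⟩
    -- Following `z` from `δ` on meets the constraints of `r` dropped in `s`, without affecting
    -- membership in the core or in `B`.
    let y' : I → Bool := fun i => if i < δ then y i else z i
    have hyy : ∀ i < δ, y i = y' i := fun i hi => by simp [y', hi]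
    have hy'r : y' ∈ cyl r := fun p hp => by
      by_cases hpδ : p.1 < δ
      · rw [← hyy _ hpδ]
        exact hys p (Finset.mem_filter.mpr ⟨hp, hpδ⟩)
      · simp only [y', hpδ, if_false]
        exact hzr p hp
    have hy' : y' ∈ B := hOsub
      (show (⟨y', dependsBelow_core J K δ hyc hyy⟩ : core J K δ) ∈ Subtype.val ⁻¹' G from hrG hy'r)
    exact hSd B hB hy' fun i hi => (hyy i hi).symm
  have hcs : ¬ Captured J (K ∩ cyl s) := hzcore s hs hzs
  rcases hB with hB | hB
  · obtain ⟨y, hy, hyN⟩ := hdense s hs hcs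
    exact hyN (hAN δ B hB (hsB hy))
  · obtain ⟨ξ, hξ, hB⟩ := mem_iUnion₂.mp hB
    exact hcs (hcap s δ δ fun y hy => ⟨ξ, hξ, B, hB, hsB hy⟩)

end Stage

/-! ### The ideal theorem for noncovers -/

section Ideal

variable {I : Type u} [LinearOrder I]

/-- A `σ`-ideal on the cube such that each compact set of noncovers lies in a closed `G_δ` set of
the ideal contains the set of all noncovers. -/
theorem nonCover_small {X : Type u} [TopologicalSpace X] (hX : ProductivelyQuasiLindelof X)
    [Uncountable I] [WellFoundedLT I] (hI : ∀ i : I, (Iio i).Countable)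
    {e : I → Code I} (he : Function.Surjective e) {U : I → Set X} (hU : ∀ i, IsOpen (U i))
    {Small : Set (I → Bool) → Prop} (hmono : ∀ ⦃A B⦄, A ⊆ B → Small B → Small A)
    (hunion : ∀ S : Set (Set (I → Bool)), S.Countable → (∀ A ∈ S, Small A) → Small (⋃₀ S))
    (hcpt : ∀ K, IsCompact K → K ⊆ NonCover U → ∃ c : Code I, K ⊆ avoiding c.1 ∧ Small (avoiding c.1)) :
    Small (NonCover U) := by
  by_contra hbig
  have := lindelofSpace_of_productively hX
  have hw : ∀ t, ∃ z ∈ NonCover U, ∀ α < t, Small (avoiding (e α).1) → z ∉ avoiding (e α).1 := by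
    intro t
    by_contra! h
    refine hbig (hmono ?_ (hunion ((fun α => avoiding (e α).1) '' {α | α < t ∧ Small (avoiding (e α).1)})
      (((hI t).mono fun α hα => hα.1).image _) (by rintro _ ⟨α, hα, rfl⟩; exact hα.2)))
    intro z hz
    obtain ⟨α, hα, hs, hzα⟩ := h z hz
    exact ⟨_, mem_image_of_mem _ ⟨hα, hs⟩, hzα⟩
  choose w hwN hw using hw
  choose A hAc hA hNA using nonCoverBelow_sigmaCompact hX hI he hU
  -- Intersecting with `A δ` keeps the members inside `NonCoverBelow U δ`; the bound `p.2 < δ` keeps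
  -- `J δ` countable and lets late `w t` avoid early stages.
  let J : I → Set (Set (I → Bool)) := fun δ => (fun p : Code I × I => avoiding p.1.1 ∩ avoiding (e p.2).1) ''
    {p | p.1 ∈ A δ ∧ p.2 < δ ∧ DependsBelow δ (avoiding (e p.2).1) ∧ Small (avoiding (e p.2).1)}
  have hJcpt : ∀ K, IsCompact K → K ⊆ NonCover U → Captured J K := by
    intro K hK hKN
    obtain ⟨c, hKc, hsmall⟩ := hcpt K hK hKN
    obtain ⟨α, rfl⟩ := he c
    obtain ⟨δ₀, hδ₀⟩ := exists_dependsBelow_avoiding hI (e α)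
    obtain ⟨δ, hδ⟩ := exists_gt_of_countable hI (S := {α, δ₀}) (by simp)
    obtain ⟨ξ, hξ⟩ := exists_gt_of_countable hI (countable_singleton δ)
    refine ⟨ξ, fun z hz => ?_⟩
    obtain ⟨a, ha, hza⟩ := mem_iUnion₂.mp (hNA δ (nonCover_subset U δ (hKN hz)))
    exact ⟨δ, hξ δ rfl, _, ⟨(a, α), ⟨ha, hδ α (by simp), hδ₀.mono (hδ δ₀ (by simp)).le, hsmall⟩, rfl⟩,
      hza, hKc hz⟩
  have hcap : ∀ K, IsClosed K → K ⊆ ⋃ δ, stage J δ → Captured J K := by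
    refine fun K => captured_of_isClosed hI hU (A := fun δ => (fun a : Code I => avoiding a.1) '' A δ)
      (fun δ => (hAc δ).image _) ?_ ?_ ?_ ?_ ?_ ?_ ?_ ?_ hJcpt
    · rintro δ _ ⟨a, ha, rfl⟩
      exact isClosed_avoiding _
    · rintro δ _ ⟨a, ha, rfl⟩
      exact (hA δ a ha).1
    · rintro δ _ ⟨a, ha, rfl⟩
      exact (hA δ a ha).2
    · intro δ
      rw [sUnion_image]
      exact hNA δ
    · intro δ
      refine Countable.image (Countable.mono ?_ ((hAc δ).prod (hI δ))) _
      exact fun p hp => ⟨hp.1, hp.2.1⟩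
    · rintro δ _ ⟨p, hp, rfl⟩
      exact (isClosed_avoiding _).inter (isClosed_avoiding _)
    · rintro δ _ ⟨p, hp, rfl⟩
      exact (hA δ p.1 hp.1).1.inter hp.2.2.1
    · rintro δ _ ⟨p, hp, rfl⟩
      exact inter_subset_left.trans (hA δ p.1 hp.1).2
  refine false_of_test_family hX U hU (⋃ δ, stage J δ)ᶜ w ?_ hwN ?_
  · intro z hz x
    by_contra! h
    have hzN : z ∈ NonCover U := ⟨x, fun i hi => by simpa using h i hi⟩
    obtain ⟨δ, hδ⟩ := hJcpt {z} isCompact_singleton (by simpa using hzN)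
    exact hz (mem_iUnion.mpr ⟨δ, hδ rfl⟩)
  · intro O hO
    obtain ⟨δ, hδ⟩ := hcap (avoiding O) (isClosed_avoiding O) fun z hz => by
      by_contra hzJ
      obtain ⟨s, hs, hzs⟩ := hO z hzJ
      exact hz s hs hzs
    have hdep : DependsBelow δ (stage J δ) := dependsBelow_stage (by
      rintro δ _ ⟨p, hp, rfl⟩
      exact (hA δ p.1 hp.1).1.inter hp.2.2.1) δ
    obtain ⟨c, -, hcov, O', hO', hcount, hcO⟩ := exists_below_countable_cover hI (O := O) hdep.compl
      fun z hz => by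
        by_contra! h
        exact hz (hδ h)
    have hall : ∀ z ∉ stage J δ, ∃ s ∈ O', z ∈ cyl s := fun z hz => by
      obtain ⟨s, hs, hzs⟩ := hcov z hz
      exact hcO s hs z hzs
    refine ⟨O', hO', hcount, fun z hz => hall z fun h => hz (mem_iUnion.mpr ⟨δ, h⟩), ?_⟩
    refine (hI δ).mono fun t ht => ?_
    by_contra hle
    have hmem : w t ∈ stage J δ := by
      by_contra h
      obtain ⟨s, hs, hts⟩ := hall _ h
      exact ht s hs hts
    obtain ⟨ξ, hξ, _, ⟨p, hp, rfl⟩, hwp⟩ := hmem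
    exact hw t p.2 ((hp.2.1.trans hξ).trans_le (not_lt.mp hle)) hp.2.2.2 hwp.2

end Ideal

/-! ### Fusion of compact sets in the countable power -/

section Fusion

variable {I : Type u}

theorem exists_avoidingfinite_support (P : Finset I) (K : Set (I → Bool)) :
    ∃ c : Code I, K ⊆ avoiding c.1 ∧ ∀ z ∈ avoiding c.1, ∃ z' ∈ K, ∀ i ∈ P, z i = z' i := by
  classical
  refine ⟨⟨{s | s ∈ (P ×ˢ (Finset.univ : Finset Bool)).powerset ∧ Disjoint (cyl s) K},
    (Finset.countable_toSet _).mono fun s hs => hs.1⟩, fun z hz s hs hzs =>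
      disjoint_left.mp hs.2 hzs hz, fun z hz => ?_⟩
  by_contra! h
  refine hz (P.image fun i => (i, z i)) ⟨?_, ?_⟩ ?_
  · rw [Finset.mem_powerset]
    intro p hp
    obtain ⟨i, hi, rfl⟩ := Finset.mem_image.mp hp
    simpa using hi
  · refine disjoint_left.mpr fun y hy hyK => ?_
    obtain ⟨i, hi, hne⟩ := h y hyK
    exact hne (hy (i, z i) (Finset.mem_image_of_mem _ hi)).symm
  · intro p hp
    obtain ⟨i, hi, rfl⟩ := Finset.mem_image.mp hp
    rfl

section boxes

variable {V : Type u} (F : V → Finset ℕ) (ι : V → ℕ → I)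

/-- The box in the power of the cube with the given sides. -/
def box (v : V) : Set (ℕ → I → Bool) := {z | ∀ k ∈ F v, z k (ι v k) = false}

theorem isOpen_box (v : V) : IsOpen (box F ι v) := by
  have : box F ι v = ⋂ k ∈ F v, {z | z k (ι v k) = false} := by ext; simp [box]
  rw [this]
  refine isOpen_biInter_finset fun k _ => ?_
  exact (isOpen_discrete {false}).preimage
    (by fun_prop : Continuous fun z : ℕ → I → Bool => z k (ι v k))

variable {X : Type u} (U : I → Set X)

/-- The noncover part of the set is covered by countably many boxes. -/
def CountablyCovered (A : Set (ℕ → I → Bool)) : Prop :=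
  ∃ W : Set V, W.Countable ∧ ∀ z ∈ A, (∀ k, z k ∈ NonCover U) → ∃ v ∈ W, z ∈ box F ι v

/-- No choice of closed `G_δ` neighbourhoods of the first `n` sets has a countably covered
product. -/
def Bad (n : ℕ) (K : ℕ → Set (I → Bool)) : Prop :=
  ∀ G : ℕ → Code I, (∀ k < n, K k ⊆ avoiding (G k).1) →
    ¬ CountablyCovered F ι U {z | ∀ k < n, z k ∈ avoiding (G k).1}

theorem Bad.congr {n : ℕ} {K L : ℕ → Set (I → Bool)} (h : ∀ k < n, K k = L k)
    (hK : Bad F ι U n K) : Bad F ι U n L :=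
  fun G hG => hK G fun k hk => (h k hk).subset.trans (hG k hk)

variable [LinearOrder I] [TopologicalSpace X]

-- Apply `nonCover_small` to the sets whose product with suitable neighbourhoods of the first `n`
-- factors is countably covered. This is a σ-ideal because countable unions of codes are codes.
variable {F ι U} in
theorem Bad.exists_succ (hX : ProductivelyQuasiLindelof X)
    [Uncountable I] [WellFoundedLT I] (hI : ∀ i : I, (Iio i).Countable)
    {e : I → Code I} (he : Function.Surjective e) (hU : ∀ i, IsOpen (U i))
    {n : ℕ} {K : ℕ → Set (I → Bool)} (hK : Bad F ι U n K) :
    ∃ L, (IsCompact L ∧ L ⊆ NonCover U) ∧ Bad F ι U (n + 1) (Function.update K n L) := by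
  classical
  by_contra! h
  have hsmall := nonCover_small hX hI he hU
    (Small := fun B => ∃ G : ℕ → Code I, (∀ k < n, K k ⊆ avoiding (G k).1) ∧
      CountablyCovered F ι U {z | (∀ k < n, z k ∈ avoiding (G k).1) ∧ z n ∈ B}) ?_ ?_ ?_
  · obtain ⟨G, hG, W, hW, hcov⟩ := hsmall
    exact hK G hG ⟨W, hW, fun z hz hzN => hcov z ⟨hz, hzN n⟩ hzN⟩
  · rintro A B hAB ⟨G, hG, W, hW, hcov⟩
    exact ⟨G, hG, W, hW, fun z hz => hcov z ⟨hz.1, hAB hz.2⟩⟩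
  · intro S hS hA
    have : Nonempty (Code I) := ⟨⟨∅, countable_empty⟩⟩
    choose! G hG W hW hcov using hA
    refine ⟨fun k => ⟨⋃ A ∈ S, (G A k).1, hS.biUnion fun A _ => (G A k).2⟩, ?_, ⋃ A ∈ S, W A,
      hS.biUnion hW, ?_⟩
    · intro k hk z hz s hs
      obtain ⟨A, hA, hsA⟩ := mem_iUnion₂.mp hs
      exact hG A hA k hk hz s hsA
    · rintro z ⟨hz, A, hA, hzA⟩ hzN
      obtain ⟨v, hv, hzv⟩ := hcov A hA z
        ⟨fun k hk s hs => hz k hk s (mem_biUnion hA hs), hzA⟩ hzN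
      exact ⟨v, mem_biUnion hA hv, hzv⟩
  · intro L hL hLN
    have := h L ⟨hL, hLN⟩
    simp only [Bad, not_forall, not_not] at this
    obtain ⟨G, hG, W, hW, hcov⟩ := this
    refine ⟨G n, ?_, G, fun k hk => ?_, W, hW, fun z hz => hcov z fun k hk => ?_⟩
    · simpa using hG n n.lt_succ_self
    · simpa [hk.ne] using hG k (hk.trans n.lt_succ_self)
    · rcases (Nat.lt_succ_iff_lt_or_eq.mp hk) with hk | rfl
      exacts [hz.1 k hk, hz.2]

theorem countablyCovered_univ (hX : ProductivelyQuasiLindelof X)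
    [Uncountable I] [WellFoundedLT I] (hI : ∀ i : I, (Iio i).Countable)
    {e : I → Code I} (he : Function.Surjective e) (hU : ∀ i, IsOpen (U i))
    (hcov : ∀ x : ℕ → X, ∃ v, ∀ k ∈ F v, x k ∈ U (ι v k)) :
    CountablyCovered F ι U univ := by
  classical
  by_contra hbad
  let P : ℕ → Set (ℕ → Set (I → Bool)) := fun n =>
    {K | (∀ k, IsCompact (K k) ∧ K k ⊆ NonCover U) ∧ Bad F ι U n K}
  have hstep : ∀ n (K : P n), ∃ L, (IsCompact L ∧ L ⊆ NonCover U) ∧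
      Bad F ι U (n + 1) (Function.update K.1 n L) := fun n K =>
    Bad.exists_succ hX hI he hU K.2.2
  choose L hL hLbad using hstep
  let Φ : ∀ n, P n := fun n => Nat.rec
    ⟨fun _ => ∅, fun _ => ⟨isCompact_empty, empty_subset _⟩, fun G _ h => hbad (by simpa using h)⟩
    (fun n K => ⟨Function.update K.1 n (L n K), fun k => by
      rcases eq_or_ne k n with rfl | hk
      · simpa using hL _ K
      · simpa [hk] using K.2.1 k, hLbad n K⟩) n
  have hΦ : ∀ n, (Φ (n + 1)).1 = Function.update (Φ n).1 n (L n (Φ n)) := fun n => rfl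
  let K : ℕ → Set (I → Bool) := fun k => (Φ (k + 1)).1 k
  have hagree : ∀ n, ∀ k < n, (Φ n).1 k = K k := by
    intro n
    induction n with
    | zero => simp
    | succ n ih =>
      intro k hk
      rcases (Nat.lt_succ_iff_lt_or_eq.mp hk) with hk | rfl
      · rw [hΦ, Function.update_of_ne hk.ne, ih k hk]
      · rfl
  have hKbad : ∀ n, Bad F ι U n K := fun n => (Φ n).2.2.congr F ι U (hagree n)
  have hKc : ∀ k, IsCompact (K k) := fun k => ((Φ (k + 1)).2.1 k).1
  have hKN : ∀ k, K k ⊆ NonCover U := fun k => ((Φ (k + 1)).2.1 k).2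
  have hKne : ∀ k, (K k).Nonempty := by
    intro k
    by_contra! hk
    -- `cyl ∅` is the whole cube, so the code `{∅}` gives an empty neighbourhood of an empty factor.
    refine hKbad (k + 1) (fun j => if j = k then ⟨{∅}, countable_singleton _⟩
      else ⟨∅, countable_empty⟩) (fun j _ => ?_) ⟨∅, countable_empty, fun z hz => ?_⟩
    · rcases eq_or_ne j k with rfl | hj
      · simp [hk]
      · simp [hj, avoiding]
    · have := hz k k.lt_succ_self
      simp [avoiding, cyl] at this
  obtain ⟨R, hR⟩ := (isCompact_univ_pi hKc).elim_finite_subcover (box F ι) (isOpen_box F ι) (by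
    intro z hz
    choose x hx using fun k => hKN k (hz k (mem_univ k))
    obtain ⟨v, hv⟩ := hcov x
    exact mem_iUnion.mpr ⟨v, fun k hk => hx k _ (hv k hk)⟩)
  let Q : Finset I := R.biUnion fun v => (F v).image (ι v)
  choose G hKG hG using fun k => exists_avoidingfinite_support Q (K k)
  -- `n` exceeds every factor index used by the finitely many boxes; later factors only need to be
  -- nonempty.
  let n := R.sup (fun v => (F v).sup id) + 1
  refine hKbad n G (fun k _ => hKG k) ⟨R, R.countable_toSet, fun z hz _ => ?_⟩
  have hz' : ∀ k, ∃ y ∈ K k, k < n → ∀ i ∈ Q, z k i = y i := by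
    intro k
    by_cases hk : k < n
    · obtain ⟨y, hy, h⟩ := hG k (z k) (hz k hk)
      exact ⟨y, hy, fun _ => h⟩
    · obtain ⟨y, hy⟩ := hKne k
      exact ⟨y, hy, fun h => absurd h hk⟩
  choose y hyK hy using hz'
  obtain ⟨v, hvR, hyv⟩ := mem_iUnion₂.mp (hR (fun k _ => hyK k))
  refine ⟨v, hvR, fun k hk => ?_⟩
  have hkn : k < n := Nat.lt_succ_of_le ((Finset.le_sup (f := id) hk).trans
    (Finset.le_sup (f := fun v => (F v).sup id) hvR))
  rw [hy k hkn _ (Finset.mem_biUnion.mpr ⟨v, hvR, Finset.mem_image_of_mem _ hk⟩)]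
  exact hyv k hk

end boxes

theorem mk_code_le (CH : (𝔠 : Cardinal.{u}) = ℵ₁) (hI : #I = ℵ₁) : #(Code I) ≤ #I := by
  have hinf : Infinite I := by
    rw [Cardinal.infinite_iff, hI]
    exact Cardinal.aleph0_le_aleph 1
  have h : #(Finset (I × Bool)) = ℵ₁ := by
    rw [Cardinal.mk_finset_of_infinite, Cardinal.mk_prod, hI]
    simpa using Cardinal.mul_eq_left (Cardinal.aleph0_le_aleph 1)
      ((Cardinal.natCast_lt_aleph0 (n := 2)).le.trans (Cardinal.aleph0_le_aleph 1)) two_ne_zero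
  calc #(Code I) = #{c : Set (Finset (I × Bool)) // #c ≤ ℵ₀} := by
        simp only [Code, Cardinal.le_aleph0_iff_set_countable]
    _ ≤ max #(Finset (I × Bool)) ℵ₀ ^ (ℵ₀ : Cardinal.{u}) := Cardinal.mk_bounded_set_le _ _
    _ = #I := by
        rw [h, max_eq_left (Cardinal.aleph0_le_aleph 1), ← CH, Cardinal.continuum_power_aleph0, CH,
          hI]

end Fusion

end CantorCube

/-! ### Transfer from the power of `X` to the power of the cube -/

open CantorCube in
theorem corollary5p3 (CH : (𝔠 : Cardinal.{0}) = ℵ₁)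
    (X : Type u) [TopologicalSpace X]
    (hX : ProductivelyQuasiLindelof X)
    (hl : lindelofNumber (ℕ → X) ≤ 𝔠) :
    PowerfullyQuasiLindelof X := by
  classical
  have CH' : (𝔠 : Cardinal.{u}) = ℵ₁ := by
    have := congrArg Cardinal.lift.{u} CH
    simpa using this
  refine (quasiLindelof_iff _).mpr fun C hCo hCc => ?_
  obtain ⟨D, hD, hDcard, hDc⟩ := (lindelofNumber_le_iff _ _).mp hl
    {B | (∃ (u : ℕ → Set X) (F : Finset ℕ), (∀ i, IsOpen (u i)) ∧ B = (F : Set ℕ).pi u) ∧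
      ∃ O ∈ C, B ⊆ O} (by
    rintro _ ⟨⟨u, F, hu, rfl⟩, -⟩
    exact isOpen_set_pi F.finite_toSet fun i _ => hu i) (by
    refine eq_univ_of_forall fun x => ?_
    obtain ⟨O, hO, hxO⟩ := mem_sUnion.mp (hCc ▸ mem_univ x)
    obtain ⟨F, u, hu, hsub⟩ := isOpen_pi_iff.mp (hCo O hO) x hxO
    -- The sides off `F` are reset to `univ` because only those in `F` are known to be open.
    have hpi : (F : Set ℕ).pi (fun i => if i ∈ F then u i else univ) = (F : Set ℕ).pi u :=
      pi_congr rfl fun i hi => if_pos hi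
    refine ⟨_, ⟨⟨_, F, fun i => ?_, rfl⟩, O, hO, hpi.trans_subset hsub⟩, ?_⟩
    · split_ifs with hi
      exacts [(hu i hi).1, isOpen_univ]
    · rw [hpi]
      exact fun i hi => (hu i hi).2)
  rcases D.eq_empty_or_nonempty with rfl | hne
  · exact ⟨∅, empty_subset _, countable_empty, hDc⟩
  have : Nonempty D := hne.to_subtype
  choose u F hu hDF using fun v : D => (hD v.2).1
  choose O hOC hDO using fun v : D => (hD v.2).2
  let I : Type u := (ℵ₁ : Cardinal.{u}).ord.ToType
  have hIc : #I = ℵ₁ := Cardinal.mk_ord_toType _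
  have hI : ∀ i : I, (Iio i).Countable := fun i => by
    rw [← Cardinal.le_aleph0_iff_set_countable, ← Cardinal.lt_aleph_one_iff]
    exact (Cardinal.mk_Iio_lt i (by simp [I])).trans_eq hIc
  have hunc : Uncountable I := by
    rw [← Cardinal.aleph0_lt_mk_iff, hIc]
    exact Cardinal.aleph0_lt_aleph_one
  obtain ⟨e, he⟩ : ∃ e : I → Code I, Function.Surjective e := by
    have : Nonempty (Code I) := ⟨⟨∅, countable_empty⟩⟩
    obtain ⟨f⟩ := mk_code_le CH' hIc
    exact ⟨_, Function.invFun_surjective f.injective⟩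
  obtain ⟨g, hg⟩ : ∃ g : I → D × ℕ, Function.Surjective g := by
    have hle : #(D × ℕ) ≤ #I := by
      rw [hIc, Cardinal.mk_prod]
      simpa using Cardinal.mul_le_of_le (Cardinal.aleph0_le_aleph 1) (hDcard.trans_eq CH')
        (Cardinal.aleph0_le_aleph 1)
    obtain ⟨f⟩ := hle
    exact ⟨_, Function.invFun_surjective f.injective⟩
  choose ι hι using fun v k => hg (v, k)
  obtain ⟨W, hW, hcov⟩ := countablyCovered_univ F ι (fun i => u (g i).1 (g i).2) hX hI he
    (fun i => hu _ _) (fun x => by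
      obtain ⟨B, hB, hxB⟩ := mem_sUnion.mp (hDc ▸ mem_univ x)
      refine ⟨⟨B, hB⟩, fun k hk => ?_⟩
      have hx : x ∈ (F ⟨B, hB⟩ : Set ℕ).pi (u ⟨B, hB⟩) := hDF ⟨B, hB⟩ ▸ hxB
      rw [hι]
      exact hx k hk)
  refine ⟨O '' W, by rintro _ ⟨v, -, rfl⟩; exact hOC v, hW.image O, eq_univ_of_forall fun x => ?_⟩
  -- Each `x k` is sent to the largest subfamily missing it, so lying in a box of the cube means
  -- that `x` lies in the original box.
  obtain ⟨v, hv, hxv⟩ := hcov (fun k i => decide (x k ∉ u (g i).1 (g i).2)) (mem_univ _)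
    fun k => ⟨x k, fun i hi => by simpa using hi⟩
  refine ⟨O v, mem_image_of_mem O hv, hDO v ?_⟩
  rw [hDF v]
  intro k hk
  have := hxv k hk
  simp only [hι] at this
  simpa using this
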